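/- For functions on $(0,1)$ let $L^2_r=L^2_r(0,1)$ be the Hilbert space with norm $\|f\|_{L^2_r}^2=\int_0^1 |f(r)|^2\,r\,dr$, and let $H^2_r(0,1)$ be the space of $\xi\in L^2_r$ whose weak derivatives $\xi',\xi''$ lie in $L^2_r$. Put $$V_0=\Big\{\xi\in H^2_r(0,1):\ \xi'(1)=0,\ \xi(0)\text{ is bounded},\ \int_0^1 r\,\xi\,dr=0\Big\},\qquad V_m=\big\{\xi\in H^2_r(0,1):\ \xi'(1)=0,\ \xi(0)=0\big\}\quad(m\ge 1).$$ For a Bond number $\mathrm{Bo}>0$, a pair $(\omega,\xi_m)\in\mathbb R\times V_m$ is a weak sloshing eigenpair of the ice-fishing problem with a circular hole if for all $g\in V_m$ $$\int_0^1\Big(\xi_m g\,r+\frac{1}{\mathrm{Bo}}\frac{m^2}{r}\xi_m g+\frac1{\mathrm{Bo}}\xi_m' g'\,r\Big)dr=\omega^2\int_0^1(\widehat S_r\xi_m)(r)\,g(r)\,r\,dr,\qquad \widehat S_r\xi_m(r)=\int_0^\infty\!\!\int_0^1 \xi_m(s)\,s\,J_m(ks)J_m(kr)\,ds\,dk,$$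 where $J_m$ is the Bessel function of the first kind. For $j\ge1$ let $h_j^m(r)=\mu_j^m r^m P^{(0,m)}_{j-1}(2r^2-1)$ with $P^{(0,m)}_{j-1}$ the Jacobi polynomials and $\mu_j^m=2\sqrt{j+\tfrac12(m-1)}$, let $P_m^{(n)}=\mathrm{span}\{h_1^m,\dots,h_n^m\}$, and $$W_m^{(n)}=\Big\{v\in P_m^{(n)}:\ v'(\pm1)=0,\ \text{and } \int_0^1 v\,r\,dr=0\text{ if }m=0\Big\}.$$ **Lemma 4.2.** There is a constant $C>0$, independent of $n$ (and of $m$, $\mathrm{Bo}$, $\omega$ and $\xi_m$), such that for every $n\ge 1$ the following holds. Let $m\ge1$, let $\mathrm{Bo}>0$, let $(\omega,\xi_m)$ be a weak sloshing eigenpair with $\xi_m\in V_m$ and $\xi_m/r\in L^2_r$, and let $\xi_m^{(n)}$ be the $L^2_r$-orthogonal projection of $\xi_m$ onto $W_m^{(n)}$. Then $$\big\|\xi_m-\xi_m^{(n)}\big\|_{L^2_r}\le C\,n^{-1}\Big(m\,\Big\|\frac{\xi_m}{r}\Big\|_{L^2_r}+\|\xi_m'\|_{L^2_r}\Big).$$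 For $m=0$ the same holds for every $\xi_0\in V_0$: $\ \|\xi_0-\xi_0^{(n)}\|_{L^2_r}\le C\,n^{-1}\|\xi_0'\|_{L^2_r}$, where $\xi_0^{(n)}$ is the $L^2_r$-orthogonal projection of $\xi_0$ onto $W_0^{(n)}$. -/

import Mathlib

open MeasureTheory Filter Topology Polynomial Set

noncomputable section

namespace IceFishing

/-- The measure `r dr` on the interval `(0, 1)`. -/
def radialMeasure : Measure ℝ :=
  (volume.restrict (Ioo (0 : ℝ) 1)).withDensity (fun r => ENNReal.ofReal r)

/-- The Hilbert space `L²_r(0,1)`, with inner product `∫₀¹ f g r dr`. -/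
abbrev L2r : Type := Lp ℝ 2 radialMeasure

/-- `f'` is a weak derivative of `f` on `(0, 1)`.  Changing `f` or `f'` on a null set, or outside
`(0, 1)`, does not matter. -/
def HasWeakDeriv (f f' : ℝ → ℝ) : Prop :=
  LocallyIntegrableOn f (Ioo 0 1) ∧ LocallyIntegrableOn f' (Ioo 0 1) ∧
    ∀ φ : ℝ → ℝ, ContDiff ℝ (⊤ : ℕ∞) φ → HasCompactSupport φ → tsupport φ ⊆ Ioo 0 1 →
      ∫ r in Ioo (0 : ℝ) 1, f r * deriv φ r = - ∫ r in Ioo (0 : ℝ) 1, f' r * φ r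

/-- The class of `f` has a representative that is continuous on `(0, 1)` and tends to `c` at the
endpoint `a`: the boundary value `f(a) = c` in the sense of traces. -/
def HasBoundaryValue (f : ℝ → ℝ) (a c : ℝ) : Prop :=
  ∃ g : ℝ → ℝ, g =ᵐ[volume.restrict (Ioo (0 : ℝ) 1)] f ∧ ContinuousOn g (Ioo 0 1) ∧
    Tendsto g (𝓝[Ioo 0 1] a) (𝓝 c)

/-- The class of `f` has a representative that is continuous on `(0, 1)` and bounded near `0`. -/
def BoundedNearZero (f : ℝ → ℝ) : Prop :=
  ∃ g : ℝ → ℝ, g =ᵐ[volume.restrict (Ioo (0 : ℝ) 1)] f ∧ ContinuousOn g (Ioo 0 1) ∧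
    ∃ B : ℝ, ∀ᶠ r in 𝓝[>] (0 : ℝ), |g r| ≤ B

/-- The space `V_m`: functions `ξ` in the weighted Sobolev space `H²_r(0,1)` (so `ξ` and its weak
derivatives `ξ'`, `ξ''` lie in `L²_r(0,1)`) with `ξ'(1) = 0`, and moreover `ξ(0)` bounded and
`∫₀¹ r ξ dr = 0` if `m = 0`, respectively `ξ(0) = 0` if `m ≥ 1`. -/
def V (m : ℕ) : Set L2r :=
  {ξ | ∃ ξ' ξ'' : L2r, HasWeakDeriv ξ ξ' ∧ HasWeakDeriv ξ' ξ'' ∧ HasBoundaryValue ξ' 1 0 ∧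
    (m = 0 → BoundedNearZero ξ ∧ ∫ r in (0 : ℝ)..1, r * ξ r = 0) ∧
    (1 ≤ m → HasBoundaryValue ξ 0 0)}

/-- The Bessel function of the first kind `J_m`, of integer order `m ≥ 0`. -/
def besselJ (m : ℕ) (x : ℝ) : ℝ :=
  ∑' k : ℕ, (-1) ^ k / ((k.factorial : ℝ) * ((k + m).factorial : ℝ)) * (x / 2) ^ (2 * k + m)

/-- The radial part of the Neumann-to-Dirichlet operator of the half-space. -/
def Shat (m : ℕ) (ξ : ℝ → ℝ) (r : ℝ) : ℝ :=
  ∫ k in Ioi (0 : ℝ), ∫ s in (0 : ℝ)..1, ξ s * s * besselJ m (k * s) * besselJ m (k * r)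

/-- `(ω, ξ)` is a weak sloshing eigenpair, with azimuthal number `m` and Bond number `Bo`, of the
ice-fishing problem with a circular hole. (Weak derivatives are unique almost everywhere, so it
does not matter that the derivatives are quantified over.) -/
def IsWeakSloshingEigenpair (m : ℕ) (Bo ω : ℝ) (ξ : L2r) : Prop :=
  ξ ∈ V m ∧ ∀ ξ' : L2r, HasWeakDeriv ξ ξ' → ∀ g ∈ V m, ∀ g' : L2r, HasWeakDeriv g g' →
    ∫ r in (0 : ℝ)..1,
        (ξ r * g r * r + 1 / Bo * ((m : ℝ) ^ 2 / r) * ξ r * g r + 1 / Bo * ξ' r * g' r * r) =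
      ω ^ 2 * ∫ r in (0 : ℝ)..1, Shat m ξ r * g r * r

/-- The Jacobi polynomial `P_k^{(α,β)}` for natural numbers `α`, `β`, expanded in powers of
`(x - 1) / 2`. -/
def jacobi (α β k : ℕ) : ℝ[X] :=
  ∑ s ∈ Finset.range (k + 1),
    C (((k + α).choose (k - s) : ℝ) * ((k + α + β + s).choose s : ℝ)) * (C (1 / 2) * (X - 1)) ^ s

/-- The radial polynomial `h_j^m(r) = μ_j^m r^m P_{j-1}^{(0,m)}(2r² - 1)`, for `j ≥ 1`, with
`μ_j^m = 2 √(j + (m - 1) / 2)`. -/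
def radialPoly (m j : ℕ) : ℝ[X] :=
  C (2 * √((j : ℝ) + ((m : ℝ) - 1) / 2)) * X ^ m * (jacobi 0 m (j - 1)).comp (2 * X ^ 2 - 1)

/-- `P_m^{(n)} = span {h_1^m, …, h_n^m}`. -/
def polySpace (m n : ℕ) : Submodule ℝ ℝ[X] :=
  Submodule.span ℝ (radialPoly m '' Icc 1 n)

/-- `W_m^{(n)}`: those `v` in `P_m^{(n)}` with `v'(±1) = 0` and, if `m = 0`, `∫₀¹ v r dr = 0`. -/
def polyW (m n : ℕ) : Submodule ℝ ℝ[X] where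
  carrier := {v | v ∈ polySpace m n ∧ (derivative v).eval 1 = 0 ∧ (derivative v).eval (-1) = 0 ∧
    (m = 0 → ∫ r in (0 : ℝ)..1, v.eval r * r = 0)}
  zero_mem' := by simp
  add_mem' := by
    rintro a b ⟨ha, ha1, ha2, ha3⟩ ⟨hb, hb1, hb2, hb3⟩
    refine ⟨add_mem ha hb, by simp [ha1, hb1], by simp [ha2, hb2], fun hm => ?_⟩
    have h := intervalIntegral.integral_add (μ := volume) (a := (0 : ℝ)) (b := 1)
      (f := fun r => a.eval r * r) (g := fun r => b.eval r * r)
      (Continuous.intervalIntegrable (by fun_prop) _ _)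
      (Continuous.intervalIntegrable (by fun_prop) _ _)
    simp only [eval_add, add_mul]
    rw [h, ha3 hm, hb3 hm, add_zero]
  smul_mem' := by
    rintro c a ⟨ha, ha1, ha2, ha3⟩
    refine ⟨Submodule.smul_mem _ c ha, by simp [ha1], by simp [ha2], fun hm => ?_⟩
    simp only [eval_smul, smul_eq_mul, mul_assoc, intervalIntegral.integral_const_mul]
    rw [ha3 hm, mul_zero]

theorem memLp_eval (p : ℝ[X]) : MemLp (fun r => p.eval r) 2 radialMeasure := by
  have hfin : IsFiniteMeasure radialMeasure := by
    refine isFiniteMeasure_withDensity_ofReal ?_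
    have h : IntegrableOn (fun r : ℝ => r) (Icc 0 1) :=
      (continuous_id.continuousOn).integrableOn_compact isCompact_Icc
    exact (h.mono_set Ioo_subset_Icc_self).2
  obtain ⟨B, hB⟩ := (isCompact_Icc (a := (0 : ℝ)) (b := 1)).exists_bound_of_continuousOn
    (f := fun r => p.eval r) (by fun_prop)
  refine MemLp.of_bound (by fun_prop) B ?_
  refine (withDensity_absolutelyContinuous _ _).ae_le ?_
  filter_upwards [ae_restrict_mem measurableSet_Ioo] with r hr
  exact hB r (Ioo_subset_Icc_self hr)

/-- A polynomial, as an element of `L²_r(0,1)`. -/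
def polyToL2r : ℝ[X] →ₗ[ℝ] L2r where
  toFun p := (memLp_eval p).toLp _
  map_add' p q := by
    rw [← MemLp.toLp_add]
    exact MemLp.toLp_congr _ _ (by simp [Filter.EventuallyEq])
  map_smul' c p := by
    rw [RingHom.id_apply, ← MemLp.toLp_const_smul]
    exact MemLp.toLp_congr _ _ (by simp [Filter.EventuallyEq])

/-- `W_m^{(n)}` as a subspace of `L²_r(0,1)`. -/
def W (m n : ℕ) : Submodule ℝ L2r :=
  (polyW m n).map polyToL2r

instance finiteDimensional_W (m n : ℕ) : FiniteDimensional ℝ (W m n) := by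
  have h1 : FiniteDimensional ℝ (polySpace m n) :=
    FiniteDimensional.span_of_finite ℝ ((finite_Icc 1 n).image _)
  have h2 : FiniteDimensional ℝ (polyW m n) :=
    Submodule.finiteDimensional_of_le (fun v hv => hv.1)
  unfold W
  infer_instance

end IceFishing

end

open IceFishing

open IceFishing

namespace IceFishing

/-! The functions h_{k+1}^m are, up to scaling, Zernike radial polynomials: eigenfunctions of the
singular operator Lu = -(1/r)(r(1-r²)u')' + (m²/r²)u with eigenvalue N(N+2), N = m+2k. Its weight
r(1-r²) vanishes at both endpoints, so pairing ξ with Lu leaves no boundary terms. Hence the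
coefficients a_k of ξ satisfy Σ λ_k a_k² ≤ E², where E = m‖ξ/r‖ + ‖ξ'‖ (`sum_zernikeEig_mul_sq_le`).
As λ_k ≥ (k+1)², except at m = k = 0 where a_0 = 0 by the zero mean, truncation after n terms costs
at most E/n.

It remains to enter W. By parity, v'(1) = 0 and v'(-1) = 0 are a single linear condition Σ c_k d_k =
0, with d_k the slope of h_{k+1}^m at 1. Projecting the truncated coefficients onto this hyperplane
moves them by |Σ a_k d_k| / (Σ d_k²)^{1/2}. Weighted Cauchy–Schwarz and Chebyshev's sum inequality
bound this by √3 E/n, because d_k²/(k+1)² is increasing in k for every m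
(`exists_constrained_approx`, `monotone_radialSlope`). The orthogonal projection is at least as good
as this competitor. -/

/-! ### The Sturm–Liouville operator and its polynomial eigenfunctions -/

/-- The polynomial `r^m q(r² - 1)`. -/
noncomputable def radialLift (m : ℕ) : ℝ[X] →ₗ[ℝ] ℝ[X] where
  toFun q := X ^ m * q.comp (X ^ 2 - 1)
  map_add' p q := by simp [mul_add]
  map_smul' c q := by simp

theorem radialLift_apply (m : ℕ) (q : ℝ[X]) : radialLift m q = X ^ m * q.comp (X ^ 2 - 1) := rfl

theorem mul_radialLift (m : ℕ) (p q : ℝ[X]) :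
    p.comp (X ^ 2 - 1) * radialLift m q = radialLift m (p * q) := by
  simp only [radialLift_apply, mul_comp]; ring

theorem X_mul_radialLift_pred {m : ℕ} (hm : 1 ≤ m) (q : ℝ[X]) :
    X * radialLift (m - 1) q = radialLift m q := by
  obtain ⟨m, rfl⟩ := Nat.exists_eq_add_of_le' hm
  simp only [radialLift_apply, Nat.add_sub_cancel]; ring

/-- The Euler operator `r d/dr` in the variable `t = r² - 1`. -/
theorem X_mul_derivative_radialLift (m : ℕ) (q : ℝ[X]) :
    X * derivative (radialLift m q) =
      radialLift m ((m : ℝ[X]) * q + 2 * (1 + X) * derivative q) := by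
  have hX : (X : ℝ[X]) * derivative (X ^ m) = (m : ℝ[X]) * X ^ m := by
    rcases m with _ | m
    · simp
    · simp; ring
  rw [radialLift_apply, derivative_mul, derivative_comp, mul_add, ← mul_assoc, hX, radialLift_apply]
  simp only [derivative_sub, derivative_X_pow, derivative_one, add_comp, mul_comp, natCast_comp,
    ofNat_comp, X_comp, one_comp]
  simp [map_ofNat C 2]
  ring

/-- The singular Sturm–Liouville operator `u ↦ -(1/r)(r(1-r²)u')' + (m²/r²)u` in the variable
`t = r² - 1`. -/
noncomputable def zernikeOp (m : ℕ) (q : ℝ[X]) : ℝ[X] :=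
  4 * (X * (1 + X) * derivative (derivative q) + (1 + ((m : ℝ[X]) + 2) * X) * derivative q) +
    ((m : ℝ[X]) ^ 2 + 2 * (m : ℝ[X])) * q

/-- The factor r clears the denominators of L: m²u/r is again a polynomial, and for m = 0 the
truncated `m - 1` is multiplied by zero. A further factor r makes every term a `radialLift`, leaving
an identity in t. -/
theorem X_mul_radialLift_zernikeOp (m : ℕ) (q : ℝ[X]) :
    X * radialLift m (zernikeOp m q) =
      -derivative (X * (1 - X ^ 2) * derivative (radialLift m q)) +
        (m : ℝ[X]) ^ 2 * radialLift (m - 1) q := by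
  apply mul_left_cancel₀ (X_ne_zero (R := ℝ))
  have h1 : X * (1 - X ^ 2) * derivative (radialLift m q) =
      radialLift m (-X * ((m : ℝ[X]) * q + 2 * (1 + X) * derivative q)) := by
    rw [← mul_radialLift, ← X_mul_derivative_radialLift]
    simp
    ring
  have h2 : X * ((m : ℝ[X]) ^ 2 * radialLift (m - 1) q) = radialLift m ((m : ℝ[X]) ^ 2 * q) := by
    rcases Nat.eq_zero_or_pos m with rfl | hm
    · simp
    · rw [← mul_radialLift, ← X_mul_radialLift_pred hm]
      simp
      ring
  have h3 : X * (X * radialLift m (zernikeOp m q)) =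
      radialLift m ((1 + X) * zernikeOp m q) := by
    rw [← mul_radialLift]
    simp
    ring
  rw [h3, mul_add, h2, h1, mul_neg, X_mul_derivative_radialLift, ← map_neg, ← map_add]
  congr 1
  simp only [zernikeOp, derivative_add, derivative_mul, derivative_neg, derivative_X,
    derivative_natCast, derivative_one, derivative_ofNat]
  ring

/-- The eigenvalue `N(N + 2)`, `N = m + 2k`. -/
noncomputable def zernikeEig (m k : ℕ) : ℝ := (m : ℝ) ^ 2 + 2 * m + 4 * k * (k + m + 1)

/-- In the monomials t^s the operator is bidiagonal. This yields both the eigenvectors and, by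
induction on s, their orthogonality. -/
theorem zernikeOp_X_pow (m s : ℕ) :
    zernikeOp m (X ^ s) = C (4 * (s : ℝ) ^ 2) * X ^ (s - 1) +
      C (zernikeEig m s) * X ^ s := by
  rcases s with _ | _ | s
  · simp [zernikeOp, zernikeEig, map_ofNat C 2]
  · simp [zernikeOp, zernikeEig, map_ofNat C 2, map_ofNat C 4]; ring
  · simp [zernikeOp, zernikeEig, map_ofNat C 2, map_ofNat C 4]; ring

theorem zernikeOp_add (m : ℕ) (p q : ℝ[X]) :
    zernikeOp m (p + q) = zernikeOp m p + zernikeOp m q := by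
  simp only [zernikeOp, derivative_add]; ring

theorem zernikeOp_C_mul (m : ℕ) (c : ℝ) (q : ℝ[X]) :
    zernikeOp m (C c * q) = C c * zernikeOp m q := by
  simp only [zernikeOp, derivative_C_mul]; ring

theorem zernikeOp_sum {ι : Type*} (m : ℕ) (s : Finset ι) (f : ι → ℝ[X]) :
    zernikeOp m (∑ i ∈ s, f i) = ∑ i ∈ s, zernikeOp m (f i) := by
  classical
  induction s using Finset.induction_on with
  | empty => simp [zernikeOp]
  | insert a s ha ih => rw [Finset.sum_insert ha, Finset.sum_insert ha, zernikeOp_add, ih]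

/-- The coefficients of `P_k^{(0,m)}` in powers of `(x - 1) / 2`. -/
noncomputable def zernikeCoeff (m k s : ℕ) : ℝ := (k.choose (k - s) : ℝ) * ((k + m + s).choose s : ℝ)

/-- `P_k^{(0,m)}(2t + 1)`. -/
noncomputable def zernikePoly (m k : ℕ) : ℝ[X] :=
  ∑ s ∈ Finset.range (k + 1), C (zernikeCoeff m k s) * X ^ s

theorem zernikeCoeff_zero (m k : ℕ) : zernikeCoeff m k 0 = 1 := by simp [zernikeCoeff]

theorem zernikeCoeff_self_pos (m k : ℕ) : 0 < zernikeCoeff m k k := by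
  simp only [zernikeCoeff, Nat.sub_self, Nat.choose_zero_right, Nat.cast_one, one_mul]
  exact_mod_cast Nat.choose_pos (by omega)

/-- This is the eigenvector recursion of the bidiagonal operator, since λ_k - λ_s = 4(k-s)(k+m+s+1).
-/
theorem zernikeCoeff_succ (m k s : ℕ) (hs : s < k) :
    ((s : ℝ) + 1) ^ 2 * zernikeCoeff m k (s + 1) =
      ((k : ℝ) - s) * (k + m + s + 1) * zernikeCoeff m k s := by
  have h1 : (k.choose (k - (s + 1)) : ℝ) * (s + 1) = k.choose (k - s) * (k - s) := by
    rw [Nat.choose_symm (by omega), Nat.choose_symm (by omega)]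
    have h := Nat.choose_succ_right_eq k s
    have h' : ((k.choose (s + 1) * (s + 1) : ℕ) : ℝ) = (k.choose s * (k - s) : ℕ) := by rw [h]
    push_cast [Nat.cast_sub hs.le] at h'
    exact h'
  have h2 : ((k + m + (s + 1)).choose (s + 1) : ℝ) * (s + 1) =
      (k + m + s + 1) * (k + m + s).choose s := by
    have h := Nat.add_one_mul_choose_eq (k + m + s) s
    have h' : (((k + m + s + 1) * (k + m + s).choose s : ℕ) : ℝ) =
      ((k + m + s + 1).choose (s + 1) * (s + 1) : ℕ) := by rw [h]
    push_cast at h'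
    rw [h', ← add_assoc]
  simp only [zernikeCoeff]
  linear_combination (k + m + (s + 1)).choose (s + 1) * ((s : ℝ) + 1) * h1 +
    k.choose (k - s) * ((k : ℝ) - s) * h2

theorem zernikeOp_zernikePoly (m k : ℕ) :
    zernikeOp m (zernikePoly m k) = C (zernikeEig m k) * zernikePoly m k := by
  -- The defect of each partial sum is its top term alone; the factor n - k removes it at n = k.
  have key : ∀ n ≤ k, zernikeOp m (∑ s ∈ Finset.range (n + 1), C (zernikeCoeff m k s) * X ^ s) -
      C (zernikeEig m k) * ∑ s ∈ Finset.range (n + 1), C (zernikeCoeff m k s) * X ^ s =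
      C (4 * ((n : ℝ) - k) * (n + k + m + 1) * zernikeCoeff m k n) * X ^ n := by
    intro n hn
    induction n with
    | zero =>
      have h := zernikeOp_X_pow m 0
      simp only [zero_add, Finset.range_one, Finset.sum_singleton, zernikeOp_C_mul, h, zernikeEig]
      simp
      ring
    | succ n ih =>
      have ih := ih (by omega)
      have hc := congrArg (fun x : ℝ => (C x : ℝ[X])) (zernikeCoeff_succ m k n hn)
      rw [Finset.sum_range_succ, zernikeOp_add, mul_add, add_sub_add_comm, ih, zernikeOp_C_mul,
        zernikeOp_X_pow]
      simp only [zernikeEig, Nat.add_sub_cancel]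
      simp only [map_mul, map_add, map_sub, map_pow, map_one, Nat.cast_add, Nat.cast_one] at hc ⊢
      have h4 : (C (4 : ℝ) : ℝ[X]) = 4 := rfl
      have h2 : (C (2 : ℝ) : ℝ[X]) = 2 := rfl
      rw [h4, h2]
      linear_combination 4 * X ^ n * hc
  have := key k le_rfl
  rw [sub_self, mul_zero, zero_mul, zero_mul, map_zero, zero_mul, sub_eq_zero] at this
  exact this

theorem radialPoly_succ (m k : ℕ) :
    radialPoly m (k + 1) =
      radialLift m (C (2 * √(((k : ℝ) + 1) + ((m : ℝ) - 1) / 2)) * zernikePoly m k) := by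
  simp only [radialPoly, jacobi, zernikePoly, zernikeCoeff, Nat.add_sub_cancel, radialLift_apply,
    mul_comp, C_comp, sum_comp, pow_comp, X_comp, sub_comp, one_comp]
  have h : (C (1 / 2) * (2 * X ^ 2 - 1 - 1) : ℝ[X]) = X ^ 2 - 1 := by
    have : (C (1 / 2) * 2 : ℝ[X]) = 1 := by
      rw [show (2 : ℝ[X]) = C 2 from rfl, ← C_mul]; norm_num
    linear_combination (X ^ 2 - 1) * this
  simp only [h, Nat.cast_add, Nat.cast_one, add_zero]
  ring

theorem zernikePoly_eval_zero (m k : ℕ) : (zernikePoly m k).eval 0 = 1 := by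
  rw [zernikePoly, Finset.sum_range_succ']
  simp [eval_finsetSum, zernikeCoeff_zero]

/-- At t = 0 the leading coefficient t(1+t) vanishes, so the eigenvalue equation determines the
slope from the value 1. -/
theorem derivative_zernikePoly_eval_zero (m k : ℕ) :
    (derivative (zernikePoly m k)).eval 0 = k * (k + m + 1) := by
  have h := congrArg (eval 0) (zernikeOp_zernikePoly m k)
  simp only [zernikeOp, eval_add, eval_mul, eval_X, eval_C, zernikePoly_eval_zero, eval_natCast,
    eval_ofNat, eval_one, eval_pow, zernikeEig] at h
  linarith

theorem derivative_radialLift_eval_one (m : ℕ) (q : ℝ[X]) :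
    (derivative (radialLift m q)).eval 1 = m * q.eval 0 + 2 * (derivative q).eval 0 := by
  have h := congrArg (eval 1) (X_mul_derivative_radialLift m q)
  simpa [radialLift_apply, eval_comp] using h

/-- Parity under r ↦ -r makes the condition at -1 equivalent to the one at 1. -/
theorem derivative_radialLift_eval_neg_one (m : ℕ) (q : ℝ[X]) :
    (derivative (radialLift m q)).eval (-1) =
      -(-1) ^ m * (derivative (radialLift m q)).eval 1 := by
  have h := congrArg (eval (-1)) (X_mul_derivative_radialLift m q)
  rw [eval_mul, eval_X, radialLift_apply m (_ + _)] at h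
  simp only [derivative_radialLift_eval_one, eval_comp, eval_mul, eval_pow, eval_add, eval_sub,
    eval_X, eval_one, eval_natCast, eval_ofNat, even_two.neg_pow, one_pow, sub_self,
    add_zero] at h ⊢
  linarith

theorem radialLift_eval_one (m : ℕ) (q : ℝ[X]) : (radialLift m q).eval 1 = q.eval 0 := by
  simp [radialLift_apply, eval_comp]

/-! ### Cutoffs and integration by parts up to the endpoints -/

/-- With x = n·(distance to an endpoint), the first bound says that a cutoff slope of size n is
compensated by a simple zero there, uniformly in n. -/
theorem exists_bound_deriv_smoothTransition :
    ∃ K : ℝ, 0 ≤ K ∧ (∀ x, |x * deriv Real.smoothTransition (x - 1)| ≤ K) ∧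
      ∀ x, 1 < x → deriv Real.smoothTransition x = 0 := by
  have hd : ContDiff ℝ 1 Real.smoothTransition := Real.smoothTransition.contDiff
  have hc : Continuous (deriv Real.smoothTransition) := hd.continuous_deriv le_rfl
  have h1 : ∀ x, 1 < x → deriv Real.smoothTransition x = 0 := by
    intro x hx
    have : Real.smoothTransition =ᶠ[𝓝 x] fun _ => 1 := by
      filter_upwards [lt_mem_nhds hx] with y hy
      exact Real.smoothTransition.one_of_one_le hy.le
    rw [this.deriv_eq, deriv_const]
  have h0 : ∀ x, x < 0 → deriv Real.smoothTransition x = 0 := by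
    intro x hx
    have : Real.smoothTransition =ᶠ[𝓝 x] fun _ => 0 := by
      filter_upwards [gt_mem_nhds hx] with y hy
      exact Real.smoothTransition.zero_of_nonpos (le_of_lt hy)
    rw [this.deriv_eq, deriv_const]
  obtain ⟨K, hK⟩ := (isCompact_Icc (a := (1 : ℝ)) (b := 2)).exists_bound_of_continuousOn
    (f := fun x => x * deriv Real.smoothTransition (x - 1)) (by fun_prop)
  have hK0 : 0 ≤ K := (norm_nonneg _).trans (hK 1 (by simp))
  refine ⟨K, hK0, fun x => ?_, h1⟩
  rcases lt_or_ge x 1 with hx | hx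
  · rw [h0 _ (by linarith)]; simpa
  rcases lt_or_ge 2 x with hx' | hx'
  · rw [h1 _ (by linarith)]; simpa
  exact hK x ⟨hx, hx'⟩

/-- A smooth cutoff that vanishes within `1/n` of `0` and of `1`. -/
noncomputable def endpointCutoff (n : ℕ) (r : ℝ) : ℝ :=
  Real.smoothTransition (n * r - 1) * Real.smoothTransition (n * (1 - r) - 1)

theorem contDiff_endpointCutoff (n : ℕ) : ContDiff ℝ (⊤ : ℕ∞) (endpointCutoff n) := by
  have h : ContDiff ℝ (⊤ : ℕ∞) Real.smoothTransition := Real.smoothTransition.contDiff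
  exact (h.comp (by fun_prop)).mul (h.comp (by fun_prop))

theorem hasDerivAt_endpointCutoff (n : ℕ) (r : ℝ) :
    HasDerivAt (endpointCutoff n)
      (n * deriv Real.smoothTransition (n * r - 1) * Real.smoothTransition (n * (1 - r) - 1) -
        Real.smoothTransition (n * r - 1) *
          (n * deriv Real.smoothTransition (n * (1 - r) - 1))) r := by
  have hd : Differentiable ℝ Real.smoothTransition :=
    (Real.smoothTransition.contDiff (n := 1)).differentiable (by simp)
  have h1 : HasDerivAt (fun r : ℝ => n * r - 1) (n : ℝ) r := by
    simpa using ((hasDerivAt_id r).const_mul (n : ℝ)).sub_const 1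
  have h2 : HasDerivAt (fun r : ℝ => n * (1 - r) - 1) (-(n : ℝ)) r := by
    simpa using (((hasDerivAt_id r).const_sub 1).const_mul (n : ℝ)).sub_const 1
  refine (((hd _).hasDerivAt.comp r h1).mul ((hd _).hasDerivAt.comp r h2)).congr_deriv ?_
  simp only [Function.comp]
  ring

theorem support_endpointCutoff_subset {n : ℕ} (hn : 1 ≤ n) :
    Function.support (endpointCutoff n) ⊆ Icc (1 / n : ℝ) (1 - 1 / n) := by
  intro r hr
  have hn' : (0 : ℝ) < n := by exact_mod_cast hn
  by_contra h
  apply hr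
  rw [mem_Icc, not_and_or, not_le, not_le] at h
  rcases h with h | h
  · rw [lt_div_iff₀ hn'] at h
    rw [endpointCutoff, Real.smoothTransition.zero_of_nonpos (by linarith), zero_mul]
  · have h' : 1 - r < 1 / n := by linarith
    rw [lt_div_iff₀ hn'] at h'
    rw [endpointCutoff, Real.smoothTransition.zero_of_nonpos (x := n * (1 - r) - 1) (by linarith),
      mul_zero]

theorem abs_endpointCutoff_le (n : ℕ) (r : ℝ) : |endpointCutoff n r| ≤ 1 := by
  rw [endpointCutoff, abs_mul, abs_of_nonneg (Real.smoothTransition.nonneg _),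
    abs_of_nonneg (Real.smoothTransition.nonneg _)]
  exact mul_le_one₀ (Real.smoothTransition.le_one _) (Real.smoothTransition.nonneg _)
    (Real.smoothTransition.le_one _)

theorem eventually_lt_mul_sub_one {r : ℝ} (hr : 0 < r) : ∀ᶠ n : ℕ in atTop, 1 < n * r - 1 := by
  have := (tendsto_natCast_atTop_atTop (R := ℝ)).atTop_mul_const hr
  filter_upwards [this.eventually_gt_atTop 2] with n hn
  linarith

/-- Integration by parts against a polynomial with zeros at both endpoints, without boundary
conditions on the weakly differentiable factor. -/
theorem HasWeakDeriv.integral_mul_derivative {ξ ξ' : ℝ → ℝ} (h : HasWeakDeriv ξ ξ')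
    (h0 : IntegrableOn ξ (Ioo 0 1)) (h1 : IntegrableOn (fun r => r * ξ' r) (Ioo 0 1))
    (φ : ℝ[X]) :
    ∫ r in Ioo (0 : ℝ) 1, ξ r * (derivative (X * (1 - X ^ 2) * φ)).eval r =
      -∫ r in Ioo (0 : ℝ) 1, ξ' r * (X * (1 - X ^ 2) * φ).eval r := by
  set ψ : ℝ[X] := X * (1 - X ^ 2) * φ with hψ
  obtain ⟨K, hK0, hK, hKz⟩ := exists_bound_deriv_smoothTransition
  obtain ⟨B, hB⟩ := (isCompact_Icc (a := (0 : ℝ)) (b := 1)).exists_bound_of_continuousOn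
    (f := fun r => (derivative ψ).eval r) (by fun_prop)
  obtain ⟨A, hA⟩ := (isCompact_Icc (a := (0 : ℝ)) (b := 1)).exists_bound_of_continuousOn
    (f := fun r => ((1 + X) * φ).eval r) (by fun_prop)
  have hA0 : 0 ≤ A := (norm_nonneg _).trans (hA 0 (by simp))
  have hψe : ∀ r, ψ.eval r = r * (1 - r) * ((1 + X) * φ).eval r := by
    intro r; simp [hψ]; ring
  have hcd : ∀ n, ContDiff ℝ (⊤ : ℕ∞) (fun r => ψ.eval r * endpointCutoff n r) := fun n =>
    (by simpa using ψ.contDiff_aeval (R := ℝ) (𝕜 := ℝ) _ : ContDiff ℝ _ _).mul (contDiff_endpointCutoff n)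
  have hder : ∀ n r, deriv (fun r => ψ.eval r * endpointCutoff n r) r =
      (derivative ψ).eval r * endpointCutoff n r + ψ.eval r * deriv (endpointCutoff n) r := by
    intro n r
    have := (ψ.hasDerivAt r).mul (hasDerivAt_endpointCutoff n r)
    rw [(hasDerivAt_endpointCutoff n r).deriv]
    exact this.deriv
  have hbound : ∀ n, ∀ r ∈ Ioo (0 : ℝ) 1, |ψ.eval r * deriv (endpointCutoff n) r| ≤ 2 * K * A := by
    intro n r hr
    rw [(hasDerivAt_endpointCutoff n r).deriv, hψe]
    -- Each factor n is paired with the distance to the endpoint where its transition takes place.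
    have e : r * (1 - r) * ((1 + X) * φ).eval r *
        (n * deriv Real.smoothTransition (n * r - 1) * Real.smoothTransition (n * (1 - r) - 1) -
        Real.smoothTransition (n * r - 1) *
          (n * deriv Real.smoothTransition (n * (1 - r) - 1))) =
        (((n * r) * deriv Real.smoothTransition (n * r - 1)) *
          ((1 - r) * Real.smoothTransition (n * (1 - r) - 1)) -
        ((n * (1 - r)) * deriv Real.smoothTransition (n * (1 - r) - 1)) *
          (r * Real.smoothTransition (n * r - 1))) * ((1 + X) * φ).eval r := by ring
    rw [e, abs_mul]
    refine mul_le_mul ?_ (hA r (Ioo_subset_Icc_self hr)) (abs_nonneg _) (by positivity)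
    have hs : ∀ y x : ℝ, 0 ≤ y → y ≤ 1 → |y * Real.smoothTransition x| ≤ 1 := by
      intro y x hy hy'
      rw [abs_mul, abs_of_nonneg hy, abs_of_nonneg (Real.smoothTransition.nonneg _)]
      exact mul_le_one₀ hy' (Real.smoothTransition.nonneg _) (Real.smoothTransition.le_one _)
    refine (abs_sub _ _).trans ?_
    rw [abs_mul, abs_mul (n * (1 - r) * _)]
    have t1 := mul_le_mul (hK (n * r)) (hs (1 - r) (n * (1 - r) - 1) (by linarith [hr.2])
      (by linarith [hr.1])) (abs_nonneg _) hK0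
    have t2 := mul_le_mul (hK (n * (1 - r))) (hs r (n * r - 1) hr.1.le hr.2.le) (abs_nonneg _) hK0
    linarith
  have hone : ∀ r ∈ Ioo (0 : ℝ) 1, ∀ᶠ n : ℕ in atTop,
      endpointCutoff n r = 1 ∧ deriv (endpointCutoff n) r = 0 := by
    intro r hr
    filter_upwards [eventually_lt_mul_sub_one hr.1,
      eventually_lt_mul_sub_one (sub_pos.2 hr.2)] with n h1 h2
    rw [(hasDerivAt_endpointCutoff n r).deriv, hKz _ h1, hKz _ h2, endpointCutoff,
      Real.smoothTransition.one_of_one_le h1.le, Real.smoothTransition.one_of_one_le h2.le]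
    simp
  have hweak : ∀ᶠ n : ℕ in atTop,
      ∫ r in Ioo (0 : ℝ) 1, ξ r * deriv (fun r => ψ.eval r * endpointCutoff n r) r =
      - ∫ r in Ioo (0 : ℝ) 1, ξ' r * (ψ.eval r * endpointCutoff n r) := by
    filter_upwards [eventually_ge_atTop 1] with n hn
    have hn' : (0 : ℝ) < n := by exact_mod_cast hn
    have hsub : Function.support (fun r => ψ.eval r * endpointCutoff n r) ⊆
        Icc (1 / n : ℝ) (1 - 1 / n) :=
      (Function.support_mul_subset_right _ _).trans (support_endpointCutoff_subset hn)
    refine h.2.2 _ (hcd n) (HasCompactSupport.of_support_subset_isCompact isCompact_Icc hsub) ?_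
    refine (closure_minimal hsub isClosed_Icc).trans fun r hr => ?_
    have : (0 : ℝ) < 1 / n := by positivity
    exact ⟨this.trans_le hr.1, hr.2.trans_lt (by linarith)⟩
  have hlim1 : Tendsto (fun n : ℕ =>
      ∫ r in Ioo (0 : ℝ) 1, ξ r * deriv (fun r => ψ.eval r * endpointCutoff n r) r) atTop
      (𝓝 (∫ r in Ioo (0 : ℝ) 1, ξ r * (derivative ψ).eval r)) := by
    refine tendsto_integral_of_dominated_convergence (fun r => |ξ r| * (B + 2 * K * A))
      (fun n => ?_) (h0.abs.mul_const _) (fun n => ?_) ?_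
    · exact h0.aestronglyMeasurable.mul
        ((hcd n).continuous_deriv (by simp)).aestronglyMeasurable
    · filter_upwards [ae_restrict_mem measurableSet_Ioo] with r hr
      rw [norm_mul, Real.norm_eq_abs, hder]
      refine mul_le_mul_of_nonneg_left ((norm_add_le _ _).trans (add_le_add ?_ (hbound n r hr)))
        (abs_nonneg _)
      rw [norm_mul]
      exact (mul_le_of_le_one_right (norm_nonneg _) (abs_endpointCutoff_le n r)).trans
        (hB r (Ioo_subset_Icc_self hr))
    · filter_upwards [ae_restrict_mem measurableSet_Ioo] with r hr
      refine tendsto_const_nhds.congr' ?_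
      filter_upwards [hone r hr] with n hn
      rw [hder, hn.1, hn.2]; ring
  have hlim2 : Tendsto (fun n : ℕ =>
      -∫ r in Ioo (0 : ℝ) 1, ξ' r * (ψ.eval r * endpointCutoff n r)) atTop
      (𝓝 (-∫ r in Ioo (0 : ℝ) 1, ξ' r * ψ.eval r)) := by
    -- Only r ξ' is known to be integrable, so the zero of ψ at 0 is spent on ξ'.
    have e : ∀ r y, ξ' r * (ψ.eval r * y) = (r * ξ' r) * ((1 - r) * ((1 + X) * φ).eval r * y) := by
      intro r y; rw [hψe]; ring
    refine Tendsto.neg ?_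
    refine tendsto_integral_of_dominated_convergence (fun r => |r * ξ' r| * A)
      (fun n => ?_) (h1.abs.mul_const _) (fun n => ?_) ?_
    · simp only [e]
      have hc := (contDiff_endpointCutoff n).continuous
      refine h1.aestronglyMeasurable.mul (Continuous.aestronglyMeasurable ?_)
      fun_prop
    · filter_upwards [ae_restrict_mem measurableSet_Ioo] with r hr
      rw [e, norm_mul, Real.norm_eq_abs]
      refine mul_le_mul_of_nonneg_left ?_ (abs_nonneg _)
      rw [norm_mul, norm_mul]
      refine (mul_le_of_le_one_right (by positivity) (abs_endpointCutoff_le n r)).trans ?_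
      refine (mul_le_of_le_one_left (norm_nonneg _) ?_).trans (hA r (Ioo_subset_Icc_self hr))
      rw [Real.norm_eq_abs, abs_of_nonneg (by linarith [hr.2])]
      linarith [hr.1]
    · filter_upwards [ae_restrict_mem measurableSet_Ioo] with r hr
      refine tendsto_const_nhds.congr' ?_
      filter_upwards [hone r hr] with n hn
      rw [hn.1, mul_one]
  exact tendsto_nhds_unique (hlim1.congr' hweak) hlim2

/-! ### The weighted space and the weak form of the operator -/

theorem integral_radialMeasure (f : ℝ → ℝ) :
    ∫ r, f r ∂radialMeasure = ∫ r in Ioo (0 : ℝ) 1, r * f r := by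
  rw [radialMeasure, integral_withDensity_eq_integral_toReal_smul (by fun_prop) (by simp)]
  refine setIntegral_congr_fun measurableSet_Ioo fun r hr => ?_
  simp [ENNReal.toReal_ofReal hr.1.le]

theorem ae_radialMeasure_iff {p : ℝ → Prop} :
    (∀ᵐ r ∂radialMeasure, p r) ↔ ∀ᵐ r ∂volume.restrict (Ioo (0 : ℝ) 1), p r := by
  rw [radialMeasure, ae_withDensity_iff (by fun_prop)]
  refine ⟨fun h => ?_, fun h => h.mono fun r hr _ => hr⟩
  filter_upwards [h, ae_restrict_mem measurableSet_Ioo] with r hr hr'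
  exact hr (by simpa using hr'.1)

theorem integrable_radialMeasure_iff {f : ℝ → ℝ} :
    Integrable f radialMeasure ↔ IntegrableOn (fun r => r * f r) (Ioo 0 1) := by
  rw [radialMeasure, integrable_withDensity_iff_integrable_smul' (by fun_prop) (by simp)]
  refine integrable_congr ?_
  filter_upwards [ae_restrict_mem measurableSet_Ioo] with r hr
  simp [ENNReal.toReal_ofReal hr.1.le]

instance : IsFiniteMeasure radialMeasure := by
  refine isFiniteMeasure_withDensity_ofReal ?_
  have h : IntegrableOn (fun r : ℝ => r) (Icc 0 1) :=
    (continuous_id.continuousOn).integrableOn_compact isCompact_Icc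
  exact (h.mono_set Ioo_subset_Icc_self).2

theorem integrableOn_id_mul_L2r (ξ : L2r) : IntegrableOn (fun r => r * ξ r) (Ioo 0 1) :=
  integrable_radialMeasure_iff.1 ((Lp.memLp ξ).integrable one_le_two)

theorem coeFn_polyToL2r (p : ℝ[X]) :
    ∀ᵐ r ∂volume.restrict (Ioo (0 : ℝ) 1), polyToL2r p r = p.eval r :=
  ae_radialMeasure_iff.1 (memLp_eval p).coeFn_toLp

theorem inner_polyToL2r (ξ : L2r) (p : ℝ[X]) :
    inner ℝ ξ (polyToL2r p) = ∫ r in Ioo (0 : ℝ) 1, r * ξ r * p.eval r := by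
  rw [L2.inner_def, integral_radialMeasure]
  refine integral_congr_ae ?_
  filter_upwards [coeFn_polyToL2r p] with r hr
  rw [hr]; simp; ring

theorem inner_polyToL2r_polyToL2r (p q : ℝ[X]) :
    inner ℝ (polyToL2r p) (polyToL2r q) = ∫ r in (0 : ℝ)..1, r * p.eval r * q.eval r := by
  rw [inner_polyToL2r, intervalIntegral.integral_of_le zero_le_one,
    ← integral_Ioc_eq_integral_Ioo.symm]
  refine integral_congr_ae ?_
  filter_upwards [coeFn_polyToL2r p] with r hr
  rw [hr]

theorem integrableOn_mul_eval {f : ℝ → ℝ} (hf : IntegrableOn f (Ioo 0 1)) (p : ℝ[X]) :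
    IntegrableOn (fun r => f r * p.eval r) (Ioo 0 1) := by
  obtain ⟨B, hB⟩ := (isCompact_Icc (a := (0 : ℝ)) (b := 1)).exists_bound_of_continuousOn
    (f := fun r => p.eval r) (by fun_prop)
  refine Integrable.mul_bdd hf (c := B) (Continuous.aestronglyMeasurable (by fun_prop)) ?_
  filter_upwards [ae_restrict_mem measurableSet_Ioo] with r hr
  exact hB r (Ioo_subset_Icc_self hr)

/-- The weak form of the Sturm–Liouville operator. -/
theorem inner_radialLift_zernikeOp {m : ℕ} {ξ ξ' η : L2r} (h : HasWeakDeriv ξ ξ')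
    (h0 : IntegrableOn ξ (Ioo 0 1))
    (hη : 1 ≤ m → ∀ᵐ r ∂volume.restrict (Ioo (0 : ℝ) 1), ξ r = r * η r) (q : ℝ[X]) :
    inner ℝ ξ (polyToL2r (radialLift m (zernikeOp m q))) =
      inner ℝ ξ' (polyToL2r ((1 - X ^ 2) * derivative (radialLift m q))) +
        (m : ℝ) ^ 2 * inner ℝ η (polyToL2r (radialLift (m - 1) q)) := by
  have hibp := h.integral_mul_derivative h0 (integrableOn_id_mul_L2r ξ')
    (derivative (radialLift m q))
  have e1 : ∀ r, r * ξ r * (radialLift m (zernikeOp m q)).eval r =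
      -(ξ r * (derivative (X * (1 - X ^ 2) * derivative (radialLift m q))).eval r) +
        (m : ℝ) ^ 2 * (ξ r * (radialLift (m - 1) q).eval r) := by
    intro r
    have := congrArg (eval r) (X_mul_radialLift_zernikeOp m q)
    simp only [eval_mul, eval_X, eval_add, eval_neg, eval_pow, eval_natCast] at this ⊢
    linear_combination ξ r * this
  rw [inner_polyToL2r, inner_polyToL2r, inner_polyToL2r]
  simp only [e1]
  have hi (p : ℝ[X]) : IntegrableOn (fun r => -(ξ r * p.eval r)) (Ioo 0 1) :=
    (integrableOn_mul_eval h0 p).neg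
  rw [integral_add (hi _) ((integrableOn_mul_eval h0 _).const_mul _),
    integral_neg, hibp, neg_neg, integral_const_mul]
  congr 1
  · refine integral_congr_ae (ae_of_all _ fun r => ?_)
    simp; ring
  · rcases Nat.eq_zero_or_pos m with rfl | hm
    · simp
    · congr 1
      refine integral_congr_ae ?_
      filter_upwards [hη hm] with r hr
      rw [hr]

theorem intervalIntegral_eq_Ioo (f : ℝ → ℝ) :
    ∫ r in (0 : ℝ)..1, f r = ∫ r in Ioo (0 : ℝ) 1, f r := by
  rw [intervalIntegral.integral_of_le zero_le_one, integral_Ioc_eq_integral_Ioo]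

theorem integrableOn_eval (p : ℝ[X]) : IntegrableOn (fun r => p.eval r) (Ioo 0 1) :=
  ((Polynomial.continuous p).continuousOn.integrableOn_compact isCompact_Icc).mono_set
    Ioo_subset_Icc_self

theorem integrableOn_polyToL2r (p : ℝ[X]) : IntegrableOn (polyToL2r p) (Ioo 0 1) :=
  (integrableOn_eval p).congr (by filter_upwards [coeFn_polyToL2r p] with r hr using hr.symm)

theorem hasWeakDeriv_polyToL2r (p : ℝ[X]) :
    HasWeakDeriv (polyToL2r p) (polyToL2r (derivative p)) := by
  refine ⟨(integrableOn_polyToL2r p).locallyIntegrableOn,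
    (integrableOn_polyToL2r _).locallyIntegrableOn, fun φ hφ _ hs => ?_⟩
  have h0 : φ 0 = 0 := image_eq_zero_of_notMem_tsupport fun h => by simpa using hs h
  have h1 : φ 1 = 0 := image_eq_zero_of_notMem_tsupport fun h => by simpa using hs h
  have hd : ∀ r, HasDerivAt φ (deriv φ r) r := fun r =>
    (hφ.differentiable (by simp) r).hasDerivAt
  have hc : Continuous (deriv φ) := hφ.continuous_deriv (by simp)
  have h := intervalIntegral.integral_mul_deriv_eq_deriv_mul (a := 0) (b := 1)
    (fun r _ => p.hasDerivAt r) (fun r _ => hd r)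
    (Continuous.intervalIntegrable (by fun_prop) _ _) (hc.intervalIntegrable _ _)
  rw [h0, h1, intervalIntegral_eq_Ioo, intervalIntegral_eq_Ioo] at h
  have e1 : ∫ r in Ioo (0 : ℝ) 1, polyToL2r p r * deriv φ r =
      ∫ r in Ioo (0 : ℝ) 1, p.eval r * deriv φ r :=
    integral_congr_ae (by filter_upwards [coeFn_polyToL2r p] with r hr; rw [hr])
  have e2 : ∫ r in Ioo (0 : ℝ) 1, polyToL2r (derivative p) r * φ r =
      ∫ r in Ioo (0 : ℝ) 1, (derivative p).eval r * φ r :=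
    integral_congr_ae (by filter_upwards [coeFn_polyToL2r (derivative p)] with r hr; rw [hr])
  rw [e1, e2, h]
  ring

theorem inner_radialLift_zernikeOp_poly (m : ℕ) (p q : ℝ[X]) :
    inner ℝ (polyToL2r (radialLift m p)) (polyToL2r (radialLift m (zernikeOp m q))) =
      inner ℝ (polyToL2r (derivative (radialLift m p)))
        (polyToL2r ((1 - X ^ 2) * derivative (radialLift m q))) +
      (m : ℝ) ^ 2 * inner ℝ (polyToL2r (radialLift (m - 1) p))
        (polyToL2r (radialLift (m - 1) q)) := by
  refine inner_radialLift_zernikeOp (hasWeakDeriv_polyToL2r _) (integrableOn_polyToL2r _)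
    (fun hm => ?_) q
  filter_upwards [coeFn_polyToL2r (radialLift m p), coeFn_polyToL2r (radialLift (m - 1) p)]
    with r h1 h2
  rw [h1, h2, ← X_mul_radialLift_pred hm, eval_mul, eval_X]

theorem inner_zernikeOp_comm (m : ℕ) (p q : ℝ[X]) :
    inner ℝ (polyToL2r (radialLift m p)) (polyToL2r (radialLift m (zernikeOp m q))) =
      inner ℝ (polyToL2r (radialLift m q)) (polyToL2r (radialLift m (zernikeOp m p))) := by
  rw [inner_radialLift_zernikeOp_poly, inner_radialLift_zernikeOp_poly,
    real_inner_comm (polyToL2r (radialLift (m - 1) p))]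
  congr 1
  rw [inner_polyToL2r_polyToL2r, inner_polyToL2r_polyToL2r]
  congr 1
  ext r
  simp only [eval_mul]
  ring

/-! ### Orthonormality and completeness -/

theorem polyToL2r_C_mul (c : ℝ) (p : ℝ[X]) : polyToL2r (C c * p) = c • polyToL2r p := by
  rw [← smul_eq_C_mul, map_smul]

theorem radialLift_C_mul (m : ℕ) (c : ℝ) (p : ℝ[X]) :
    radialLift m (C c * p) = C c * radialLift m p := by
  rw [← smul_eq_C_mul, map_smul, smul_eq_C_mul]

theorem zernikeEig_strictMono (m : ℕ) : StrictMono (zernikeEig m) := by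
  refine strictMono_nat_of_lt_succ fun k => ?_
  simp only [zernikeEig]
  push_cast
  have : (0 : ℝ) ≤ m := by positivity
  have : (0 : ℝ) ≤ k := by positivity
  nlinarith

/-- `R_k^m`, the Zernike radial polynomial, in `L²_r`. -/
noncomputable def zernikeL2 (m k : ℕ) : L2r := polyToL2r (radialLift m (zernikePoly m k))

/-- Symmetry of L and its bidiagonal form give (λ_k - λ_s)⟨R_k, r^m t^s⟩ = 4s²⟨R_k, r^m t^{s-1}⟩;
the right side vanishes by induction, and the eigenvalues are distinct. -/
theorem inner_zernikeL2_X_pow (m k s : ℕ) (hs : s < k) :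
    inner ℝ (zernikeL2 m k) (polyToL2r (radialLift m (X ^ s))) = 0 := by
  induction s using Nat.strong_induction_on with
  | _ s ih =>
    have h0 : 4 * (s : ℝ) ^ 2 *
        inner ℝ (zernikeL2 m k) (polyToL2r (radialLift m (X ^ (s - 1)))) = 0 := by
      rcases s with _ | s
      · simp
      · rw [Nat.add_sub_cancel, ih s (Nat.lt_succ_self s) (by omega), mul_zero]
    have h := inner_zernikeOp_comm m (X ^ s) (zernikePoly m k)
    rw [zernikeOp_zernikePoly, zernikeOp_X_pow] at h
    simp only [radialLift_C_mul, polyToL2r_C_mul, map_add, inner_add_right, inner_smul_right] at h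
    rw [real_inner_comm] at h
    have hlt := zernikeEig_strictMono m hs
    have : (inner ℝ (zernikeL2 m k) (polyToL2r (radialLift m (X ^ s)))) *
        (zernikeEig m k - zernikeEig m s) = 0 := by
      simp only [zernikeL2] at h0 ⊢
      rw [h0] at h
      linear_combination h
    exact (mul_eq_zero.1 this).resolve_right (by linarith)

theorem inner_zernikeL2_of_lt (m : ℕ) {j k : ℕ} (h : j < k) :
    inner ℝ (zernikeL2 m k) (zernikeL2 m j) = 0 := by
  conv_lhs => arg 3; rw [zernikeL2, zernikePoly]
  rw [map_sum, map_sum, inner_sum]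
  refine Finset.sum_eq_zero fun s hs => ?_
  rw [radialLift_C_mul, polyToL2r_C_mul, inner_smul_right, inner_zernikeL2_X_pow, mul_zero]
  have := Finset.mem_range.1 hs
  omega

/-- Modulo lower powers of t, which are orthogonal to R_k, the operator r d/dr multiplies the top
term r^m t^k by m + 2k. -/
theorem inner_zernikeL2_euler (m k : ℕ) :
    inner ℝ (zernikeL2 m k) (polyToL2r (X * derivative (radialLift m (zernikePoly m k)))) =
      ((m : ℝ) + 2 * k) * inner ℝ (zernikeL2 m k) (zernikeL2 m k) := by
  have e : X * derivative (radialLift m (zernikePoly m k)) =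
      C ((m : ℝ) + 2 * k) * radialLift m (zernikePoly m k) +
        radialLift m (∑ s ∈ Finset.range (k + 1), (C (zernikeCoeff m k s * (2 * s)) * X ^ (s - 1) +
          C (zernikeCoeff m k s * (2 * (s - k))) * X ^ s)) := by
    rw [X_mul_derivative_radialLift, ← radialLift_C_mul, ← map_add]
    congr 1
    rw [zernikePoly, derivative_sum, Finset.mul_sum, Finset.mul_sum, Finset.mul_sum,
      ← Finset.sum_add_distrib, ← Finset.sum_add_distrib]
    refine Finset.sum_congr rfl fun s _ => ?_
    rcases s with _ | s
    · simp [map_ofNat C 2]; ring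
    · simp [map_ofNat C 2]; ring
  rw [e, map_add, inner_add_right, polyToL2r_C_mul, inner_smul_right]
  rw [map_sum, map_sum, inner_sum, Finset.sum_eq_zero, add_zero]
  · rfl
  intro s hs
  have hs' := Finset.mem_range.1 hs
  simp only [radialLift_C_mul, polyToL2r_C_mul, map_add, inner_add_right, inner_smul_right]
  have h1 : zernikeCoeff m k s * (2 * s) *
      inner ℝ (zernikeL2 m k) (polyToL2r (radialLift m (X ^ (s - 1)))) = 0 := by
    rcases s with _ | s
    · simp
    · rw [inner_zernikeL2_X_pow m k _ (by omega), mul_zero]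
  have h2 : zernikeCoeff m k s * (2 * (s - k)) *
      inner ℝ (zernikeL2 m k) (polyToL2r (radialLift m (X ^ s))) = 0 := by
    rcases Nat.lt_succ_iff_lt_or_eq.1 hs' with h | rfl
    · rw [inner_zernikeL2_X_pow m k _ h, mul_zero]
    · simp
  rw [h1, h2, add_zero]

/-- Integrating (r²u²)' over (0,1), with u(1) = 1, gives 1 = 2‖u‖² + 2⟨u, ru'⟩, and the Euler
identity evaluates the last term. -/
theorem inner_zernikeL2_self (m k : ℕ) :
    2 * ((m : ℝ) + 2 * k + 1) * inner ℝ (zernikeL2 m k) (zernikeL2 m k) = 1 := by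
  set u := radialLift m (zernikePoly m k) with hu
  have h1 := inner_zernikeL2_euler m k
  rw [← hu] at h1
  have hu1 : u.eval 1 = 1 := by rw [hu, radialLift_eval_one, zernikePoly_eval_zero]
  have hftc : ∫ r in (0 : ℝ)..1, (derivative (X ^ 2 * u ^ 2)).eval r = 1 := by
    rw [intervalIntegral.integral_eq_sub_of_hasDerivAt
      (fun r _ => (X ^ 2 * u ^ 2 : ℝ[X]).hasDerivAt r)
      (Continuous.intervalIntegrable (by fun_prop) _ _)]
    simp [hu1]
  have h2 : ∫ r in (0 : ℝ)..1, (derivative (X ^ 2 * u ^ 2)).eval r =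
      2 * inner ℝ (zernikeL2 m k) (zernikeL2 m k) +
        2 * inner ℝ (zernikeL2 m k) (polyToL2r (X * derivative u)) := by
    simp only [zernikeL2]
    rw [inner_polyToL2r_polyToL2r, inner_polyToL2r_polyToL2r,
      ← intervalIntegral.integral_const_mul, ← intervalIntegral.integral_const_mul,
      ← intervalIntegral.integral_add (Continuous.intervalIntegrable (by fun_prop) _ _)
        (Continuous.intervalIntegrable (by fun_prop) _ _)]
    congr 1
    ext r
    simp only [← hu, derivative_mul, derivative_pow, eval_add, eval_mul, eval_pow, eval_X, eval_C]
    simp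
    ring
  rw [hftc] at h2
  linear_combination -h2 - 2 * h1

/-- The basis functions `h_{k+1}^m` in `L²_r`. -/
noncomputable def radialBasis (m k : ℕ) : L2r := polyToL2r (radialPoly m (k + 1))

theorem radialBasis_eq (m k : ℕ) :
    radialBasis m k = (2 * √(((k : ℝ) + 1) + ((m : ℝ) - 1) / 2)) • zernikeL2 m k := by
  rw [radialBasis, radialPoly_succ, radialLift_C_mul, polyToL2r_C_mul, zernikeL2]

theorem sq_normalization (m k : ℕ) :
    (2 * √(((k : ℝ) + 1) + ((m : ℝ) - 1) / 2)) ^ 2 = 2 * ((m : ℝ) + 2 * k + 1) := by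
  rw [mul_pow, Real.sq_sqrt]
  · ring
  · have : (0 : ℝ) ≤ m := by positivity
    have : (0 : ℝ) ≤ k := by positivity
    linarith

theorem orthonormal_radialBasis (m : ℕ) : Orthonormal ℝ (radialBasis m) := by
  rw [orthonormal_iff_ite]
  intro i j
  rw [radialBasis_eq, radialBasis_eq, inner_smul_left, inner_smul_right]
  split_ifs with h
  · subst h
    rw [← mul_assoc]
    simp only [conj_trivial]
    rw [← pow_two, sq_normalization, inner_zernikeL2_self]
  · rcases lt_or_gt_of_ne h with h | h
    · rw [real_inner_comm, inner_zernikeL2_of_lt m h]; simp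
    · rw [inner_zernikeL2_of_lt m h]; simp

theorem inner_X_pow_eq_zero {m : ℕ} {f : L2r} (hf : ∀ k, inner ℝ f (radialBasis m k) = 0) (s : ℕ) :
    inner ℝ f (polyToL2r (radialLift m (X ^ s))) = 0 := by
  induction s using Nat.strong_induction_on with
  | _ s ih =>
    have hz : inner ℝ f (zernikeL2 m s) = 0 := by
      have h := hf s
      rw [radialBasis_eq, inner_smul_right] at h
      refine (mul_eq_zero.1 h).resolve_left fun h0 => ?_
      have := sq_normalization m s
      rw [h0] at this
      have : (0 : ℝ) < 2 * ((m : ℝ) + 2 * s + 1) := by positivity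
      linarith
    rw [zernikeL2, zernikePoly, Finset.sum_range_succ, map_add, map_add, inner_add_right, map_sum,
      map_sum, inner_sum, Finset.sum_eq_zero, zero_add, radialLift_C_mul, polyToL2r_C_mul,
      inner_smul_right] at hz
    · exact (mul_eq_zero.1 hz).resolve_left (zernikeCoeff_self_pos m s).ne'
    · intro i hi
      rw [radialLift_C_mul, polyToL2r_C_mul, inner_smul_right, ih i (Finset.mem_range.1 hi),
        mul_zero]

/-- By triangularity f is orthogonal to all r^m q(r²-1). Weierstrass approximation of g(√(1+t)) on
[-1,0] then makes r^{m+1} f orthogonal to every continuous g, hence zero almost everywhere. -/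
theorem eq_zero_of_forall_inner_radialBasis {m : ℕ} {f : L2r}
    (hf : ∀ k, inner ℝ f (radialBasis m k) = 0) : f = 0 := by
  have hq : ∀ q : ℝ[X], ∫ r in Ioo (0 : ℝ) 1, (r * f r * r ^ m) * q.eval (r ^ 2 - 1) = 0 := by
    intro q
    have h : inner ℝ f (polyToL2r (radialLift m q)) = 0 := by
      rw [q.as_sum_range_C_mul_X_pow, map_sum, map_sum, inner_sum]
      refine Finset.sum_eq_zero fun s _ => ?_
      rw [radialLift_C_mul, polyToL2r_C_mul, inner_smul_right, inner_X_pow_eq_zero hf, mul_zero]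
    rw [inner_polyToL2r] at h
    refine (integral_congr_ae (ae_of_all _ fun r => ?_)).trans h
    simp [radialLift_apply, eval_comp]
    ring
  have hint : IntegrableOn (fun r => r * f r * r ^ m) (Ioo 0 1) := by
    simpa using integrableOn_mul_eval (integrableOn_id_mul_L2r f) (X ^ m)
  have hcont : ∀ g : ℝ → ℝ, Continuous g →
      ∫ r in Ioo (0 : ℝ) 1, (r * f r * r ^ m) * g r = 0 := by
    intro g hg
    set M := ∫ r in Ioo (0 : ℝ) 1, |r * f r * r ^ m| with hM
    have hM0 : 0 ≤ M := integral_nonneg fun _ => abs_nonneg _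
    refine abs_nonpos_iff.1 (le_of_forall_pos_le_add fun ε hε => ?_)
    obtain ⟨q, hqg⟩ := exists_polynomial_near_of_continuousOn (-1) 0
      (fun t => g (√(1 + t))) (by fun_prop) (ε / (M + 1)) (by positivity)
    have hgi : IntegrableOn (fun r => (r * f r * r ^ m) * g r) (Ioo 0 1) := by
      obtain ⟨B, hB⟩ := (isCompact_Icc (a := (0 : ℝ)) (b := 1)).exists_bound_of_continuousOn
        (f := g) (by fun_prop)
      refine Integrable.mul_bdd hint (c := B) hg.aestronglyMeasurable ?_
      filter_upwards [ae_restrict_mem measurableSet_Ioo] with r hr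
      exact hB r (Ioo_subset_Icc_self hr)
    have hqi : IntegrableOn (fun r => (r * f r * r ^ m) * q.eval (r ^ 2 - 1)) (Ioo 0 1) :=
      (integrableOn_mul_eval hint (q.comp (X ^ 2 - 1))).congr_fun
        (fun r _ => by simp [eval_comp]) measurableSet_Ioo
    have e : ∫ r in Ioo (0 : ℝ) 1, (r * f r * r ^ m) * g r =
        ∫ r in Ioo (0 : ℝ) 1, (r * f r * r ^ m) * (g r - q.eval (r ^ 2 - 1)) := by
      simp only [mul_sub]
      rw [integral_sub hgi hqi, hq, sub_zero]
    rw [e, zero_add]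
    calc |∫ r in Ioo (0 : ℝ) 1, (r * f r * r ^ m) * (g r - q.eval (r ^ 2 - 1))|
        ≤ ∫ r in Ioo (0 : ℝ) 1, |r * f r * r ^ m| * (ε / (M + 1)) := by
          rw [← Real.norm_eq_abs]
          refine norm_integral_le_of_norm_le (hint.abs.mul_const _) ?_
          filter_upwards [ae_restrict_mem measurableSet_Ioo] with r hr
          rw [norm_mul, Real.norm_eq_abs, Real.norm_eq_abs]
          refine mul_le_mul_of_nonneg_left ?_ (abs_nonneg _)
          have h := hqg (r ^ 2 - 1) ⟨by nlinarith [hr.1, hr.2], by nlinarith [hr.1, hr.2]⟩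
          rw [show 1 + (r ^ 2 - 1) = r ^ 2 by ring, Real.sqrt_sq hr.1.le, abs_sub_comm] at h
          exact h.le
      _ = M * (ε / (M + 1)) := integral_mul_const _ _
      _ ≤ ε := by
          rw [mul_div_assoc', div_le_iff₀ (by positivity)]
          nlinarith
  have hae : ∀ᵐ r ∂volume, r ∈ Ioo (0 : ℝ) 1 → r * f r * r ^ m = 0 := by
    refine isOpen_Ioo.ae_eq_zero_of_integral_contDiff_smul_eq_zero hint.locallyIntegrableOn
      fun g hg hgc hgs => ?_
    have h := hcont g hg.continuous
    rw [← h, ← integral_indicator measurableSet_Ioo]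
    congr 1
    ext r
    by_cases hr : r ∈ Ioo (0 : ℝ) 1
    · rw [indicator_of_mem hr, smul_eq_mul, mul_comm]
    · rw [indicator_of_notMem hr, image_eq_zero_of_notMem_tsupport fun h => hr (hgs h), zero_smul]
  refine (Lp.eq_zero_iff_ae_eq_zero).2 (ae_radialMeasure_iff.2 ?_)
  rw [ae_restrict_iff' measurableSet_Ioo]
  filter_upwards [hae] with r h hr
  have h := h hr
  have hr0 := hr.1.ne'
  simpa [hr0] using h

/-! ### The energy bound on the coefficients -/

/-- The polynomial `q` with `h_{k+1}^m(r) = r^m q(r² - 1)`. -/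
noncomputable def radialCore (m k : ℕ) : ℝ[X] :=
  C (2 * √(((k : ℝ) + 1) + ((m : ℝ) - 1) / 2)) * zernikePoly m k

theorem radialPoly_eq_radialLift (m k : ℕ) :
    radialPoly m (k + 1) = radialLift m (radialCore m k) := radialPoly_succ m k

theorem zernikeOp_radialCore (m k : ℕ) :
    zernikeOp m (radialCore m k) = C (zernikeEig m k) * radialCore m k := by
  rw [radialCore, zernikeOp_C_mul, zernikeOp_zernikePoly]; ring

theorem norm_sq_polyToL2r_one_sub_sq_mul_le (p : ℝ[X]) :
    ‖polyToL2r ((1 - X ^ 2) * p)‖ ^ 2 ≤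
      inner ℝ (polyToL2r p) (polyToL2r ((1 - X ^ 2) * p)) := by
  rw [← real_inner_self_eq_norm_sq, inner_polyToL2r_polyToL2r, inner_polyToL2r_polyToL2r]
  refine intervalIntegral.integral_mono_on zero_le_one
    (Continuous.intervalIntegrable (by fun_prop) _ _)
    (Continuous.intervalIntegrable (by fun_prop) _ _) fun r hr => ?_
  simp only [eval_mul, eval_sub, eval_one, eval_pow, eval_X]
  have h1 : 0 ≤ 1 - r ^ 2 := by nlinarith [hr.1, hr.2]
  have h2 : 1 - r ^ 2 ≤ 1 := by nlinarith [hr.1, hr.2]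
  have h3 : 0 ≤ r * (eval r p) ^ 2 * (1 - r ^ 2) :=
    mul_nonneg (mul_nonneg hr.1 (sq_nonneg _)) h1
  nlinarith [mul_le_mul_of_nonneg_left h2 h3]

/-- For the partial sum u, the left side S equals both ⟨u, Lu⟩ and ⟨ξ, Lu⟩. The first is the energy
of u, which dominates ‖(1-r²)u'‖² and m²‖u/r‖². Cauchy–Schwarz on the weak form of the second gives
S ≤ √S (m‖η‖ + ‖ξ'‖). -/
theorem sum_zernikeEig_mul_sq_le {m : ℕ} {ξ ξ' η : L2r} (h : HasWeakDeriv ξ ξ')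
    (h0 : IntegrableOn ξ (Ioo 0 1))
    (hη : 1 ≤ m → ∀ᵐ r ∂volume.restrict (Ioo (0 : ℝ) 1), ξ r = r * η r) (n : ℕ) :
    ∑ k ∈ Finset.range n, zernikeEig m k * (inner ℝ ξ (radialBasis m k)) ^ 2 ≤
      ((m : ℝ) * ‖η‖ + ‖ξ'‖) ^ 2 := by
  set a : ℕ → ℝ := fun k => inner ℝ ξ (radialBasis m k) with ha
  set S := ∑ k ∈ Finset.range n, zernikeEig m k * (a k) ^ 2 with hS
  set q : ℝ[X] := ∑ k ∈ Finset.range n, C (a k) * radialCore m k with hq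
  have hb (k : ℕ) : polyToL2r (radialLift m (radialCore m k)) = radialBasis m k := by
    rw [radialBasis, radialPoly_eq_radialLift]
  have hTq : polyToL2r (radialLift m q) = ∑ k ∈ Finset.range n, a k • radialBasis m k := by
    rw [hq, map_sum, map_sum]
    exact Finset.sum_congr rfl fun k _ => by rw [radialLift_C_mul, polyToL2r_C_mul, hb]
  have hTL : polyToL2r (radialLift m (zernikeOp m q)) =
      ∑ k ∈ Finset.range n, (zernikeEig m k * a k) • radialBasis m k := by
    rw [hq, zernikeOp_sum, map_sum, map_sum]
    refine Finset.sum_congr rfl fun k _ => ?_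
    rw [zernikeOp_C_mul, zernikeOp_radialCore, radialLift_C_mul, radialLift_C_mul, polyToL2r_C_mul,
      polyToL2r_C_mul, hb, smul_smul, mul_comm]
  have hS1 : S = inner ℝ ξ (polyToL2r (radialLift m (zernikeOp m q))) := by
    rw [hTL, inner_sum]
    refine Finset.sum_congr rfl fun k _ => ?_
    rw [inner_smul_right]; simp only [ha]; ring
  have hS2 : S = inner ℝ (polyToL2r (radialLift m q))
      (polyToL2r (radialLift m (zernikeOp m q))) := by
    rw [hTL, hTq, (orthonormal_radialBasis m).inner_sum]
    refine Finset.sum_congr rfl fun k _ => ?_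
    simp only [conj_trivial]; ring
  rw [inner_radialLift_zernikeOp h h0 hη] at hS1
  rw [inner_radialLift_zernikeOp_poly, real_inner_self_eq_norm_sq] at hS2
  set A := ‖polyToL2r ((1 - X ^ 2) * derivative (radialLift m q))‖
  set B := ‖polyToL2r (radialLift (m - 1) q)‖
  have hA := norm_sq_polyToL2r_one_sub_sq_mul_le (derivative (radialLift m q))
  have hA0 : A ^ 2 ≤ S := by nlinarith [mul_nonneg (sq_nonneg (m : ℝ)) (sq_nonneg B)]
  have hB0 : (m * B) ^ 2 ≤ S := by rw [mul_pow]; nlinarith [sq_nonneg A]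
  have hS0 : 0 ≤ S := (sq_nonneg _).trans hA0
  have hA1 : A ≤ √S := Real.le_sqrt_of_sq_le hA0
  have hB1 : m * B ≤ √S := Real.le_sqrt_of_sq_le hB0
  have i1 := (real_inner_le_norm ξ' _).trans (mul_le_mul_of_nonneg_left hA1 (norm_nonneg ξ'))
  have i2 := mul_le_mul_of_nonneg_left (real_inner_le_norm η (polyToL2r (radialLift (m - 1) q)))
    (sq_nonneg (m : ℝ))
  have i3 := mul_le_mul_of_nonneg_left hB1 (mul_nonneg (Nat.cast_nonneg (α := ℝ) m) (norm_nonneg η))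
  have hle : √S * √S ≤ √S * (m * ‖η‖ + ‖ξ'‖) := by
    rw [Real.mul_self_sqrt hS0]
    linarith
  have hE : 0 ≤ m * ‖η‖ + ‖ξ'‖ := by positivity
  have : √S ≤ m * ‖η‖ + ‖ξ'‖ := by
    rcases (Real.sqrt_nonneg S).eq_or_lt with h | h
    · rw [← h]; exact hE
    · exact le_of_mul_le_mul_left hle h
  rw [← Real.sq_sqrt hS0]
  exact pow_le_pow_left₀ (Real.sqrt_nonneg _) this 2

/-! ### Approximation under one linear constraint -/

theorem cube_le_three_mul_sum_sq (n : ℕ) :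
    (n : ℝ) ^ 3 ≤ 3 * ∑ k ∈ Finset.range n, ((k : ℝ) + 1) ^ 2 := by
  induction n with
  | zero => simp
  | succ n ih =>
    rw [Finset.sum_range_succ]
    push_cast
    have : (0 : ℝ) ≤ n := by positivity
    nlinarith

/-- If `d_k² / (k + 1)²` is monotone, then Chebyshev's sum inequality gains a factor `n⁻²`. -/
theorem sum_sq_div_sq_le {d : ℕ → ℝ} (hd : Monotone fun k => d k ^ 2 / ((k : ℝ) + 1) ^ 2) (n : ℕ) :
    (n : ℝ) ^ 2 * ∑ k ∈ Finset.range n, d k ^ 2 / ((k : ℝ) + 1) ^ 2 ≤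
      3 * ∑ k ∈ Finset.range n, d k ^ 2 := by
  rcases Nat.eq_zero_or_pos n with rfl | hn
  · simp
  have hmono : Monotone fun k : ℕ => ((k : ℝ) + 1) ^ 2 := fun i j hij => by
    have : (i : ℝ) ≤ j := by exact_mod_cast hij
    simp only
    gcongr
  have h := ((hd.monovary hmono).monovaryOn (Finset.range n : Set ℕ)).sum_mul_sum_le_card_mul_sum
  have e : ∀ k : ℕ, d k ^ 2 / ((k : ℝ) + 1) ^ 2 * ((k : ℝ) + 1) ^ 2 = d k ^ 2 := fun k =>
    div_mul_cancel₀ _ (by positivity)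
  simp only [e, Finset.card_range] at h
  have hw : 0 ≤ ∑ k ∈ Finset.range n, d k ^ 2 / ((k : ℝ) + 1) ^ 2 :=
    Finset.sum_nonneg fun k _ => by positivity
  have h3 := mul_le_mul_of_nonneg_left (cube_le_three_mul_sum_sq n) hw
  have hn' : (0 : ℝ) < n := by exact_mod_cast hn
  refine le_of_mul_le_mul_left ?_ hn'
  nlinarith

section Hilbert

variable {H : Type*} [NormedAddCommGroup H] [InnerProductSpace ℝ H] [CompleteSpace H]

theorem norm_sub_sum_le_div {b : ℕ → H} (hb : Orthonormal ℝ b)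
    (hc : ∀ f : H, (∀ k, inner ℝ f (b k) = 0) → f = 0) {x : H} {E : ℝ} (hE : 0 ≤ E)
    (h : ∀ n, ∑ k ∈ Finset.range n, ((k : ℝ) + 1) ^ 2 * inner ℝ x (b k) ^ 2 ≤ E ^ 2)
    {n : ℕ} (hn : 1 ≤ n) :
    ‖x - ∑ k ∈ Finset.range n, inner ℝ x (b k) • b k‖ ≤ E / n := by
  have hn' : (0 : ℝ) < n := by exact_mod_cast hn
  have hbot : (Submodule.span ℝ (Set.range b))ᗮ = ⊥ := by
    rw [Submodule.eq_bot_iff]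
    intro f hf
    exact hc f fun k => (Submodule.mem_orthogonal' _ _).1 hf _ (Submodule.subset_span ⟨k, rfl⟩)
  have hs : HasSum (fun k => inner ℝ x (b k) • b k) x := by
    have := (HilbertBasis.mkOfOrthogonalEqBot hb hbot).hasSum_repr x
    simpa [HilbertBasis.repr_apply_apply, real_inner_comm] using this
  have hlim := (hs.tendsto_sum_nat.sub_const
    (∑ k ∈ Finset.range n, inner ℝ x (b k) • b k)).norm
  refine le_of_tendsto hlim ?_
  filter_upwards [eventually_ge_atTop n] with N hN
  rw [← Finset.sum_Ico_eq_sub _ hN]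
  refine abs_le_of_sq_le_sq' (a := ‖_‖) ?_ (by positivity) |>.2
  rw [← real_inner_self_eq_norm_sq, hb.inner_sum, div_pow, le_div_iff₀ (by positivity)]
  refine le_trans ?_ (h N)
  rw [Finset.range_eq_Ico, ← Finset.sum_Ico_consecutive _ (Nat.zero_le n) hN, Finset.sum_mul]
  refine le_add_of_nonneg_of_le (Finset.sum_nonneg fun k _ => by positivity)
    (Finset.sum_le_sum fun k hk => ?_)
  have hk' : (n : ℝ) ≤ k := by exact_mod_cast (Finset.mem_Ico.1 hk).1
  have : (n : ℝ) ^ 2 ≤ ((k : ℝ) + 1) ^ 2 := by gcongr; linarith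
  simp only [conj_trivial]
  nlinarith [mul_le_mul_of_nonneg_right this (sq_nonneg (inner ℝ x (b k)))]

/-- Truncating an expansion and imposing one linear constraint `∑ c_k d_k = 0` on the coefficients
keeps the rate `n⁻¹`, provided that `d` grows regularly. -/
theorem exists_constrained_approx {b : ℕ → H} (hb : Orthonormal ℝ b)
    (hc : ∀ f : H, (∀ k, inner ℝ f (b k) = 0) → f = 0) {x : H} {E : ℝ} (hE : 0 ≤ E)
    (h : ∀ n, ∑ k ∈ Finset.range n, ((k : ℝ) + 1) ^ 2 * inner ℝ x (b k) ^ 2 ≤ E ^ 2)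
    {d : ℕ → ℝ} (hd : Monotone fun k => d k ^ 2 / ((k : ℝ) + 1) ^ 2) {n : ℕ} (hn : 1 ≤ n) :
    ∃ γ : ℝ, ∑ k ∈ Finset.range n, (inner ℝ x (b k) - γ * d k) * d k = 0 ∧
      ‖x - ∑ k ∈ Finset.range n, (inner ℝ x (b k) - γ * d k) • b k‖ ≤ 3 * (E / n) := by
  have hn' : (0 : ℝ) < n := by exact_mod_cast hn
  set D := ∑ k ∈ Finset.range n, d k ^ 2 with hD
  set P := ∑ k ∈ Finset.range n, inner ℝ x (b k) * d k with hP
  have hD0 : 0 ≤ D := Finset.sum_nonneg fun k _ => sq_nonneg _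
  -- Cauchy–Schwarz with the weight k+1 on the coefficients and 1/(k+1) on d.
  have hcs : P ^ 2 ≤ E ^ 2 * ∑ k ∈ Finset.range n, d k ^ 2 / ((k : ℝ) + 1) ^ 2 := by
    have := Finset.sum_mul_sq_le_sq_mul_sq (Finset.range n)
      (fun k => ((k : ℝ) + 1) * inner ℝ x (b k)) (fun k => d k / ((k : ℝ) + 1))
    have e : ∀ k : ℕ, ((k : ℝ) + 1) * inner ℝ x (b k) * (d k / ((k : ℝ) + 1)) =
        inner ℝ x (b k) * d k := fun k => by
      have : (k : ℝ) + 1 ≠ 0 := by positivity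
      field_simp
    simp only [e, mul_pow, div_pow] at this
    exact this.trans (mul_le_mul_of_nonneg_right (h n)
      (Finset.sum_nonneg fun k _ => by positivity))
  have hPD : P ^ 2 * (n : ℝ) ^ 2 ≤ 3 * E ^ 2 * D := by
    have h1 := mul_le_mul_of_nonneg_left (sum_sq_div_sq_le hd n) (sq_nonneg E)
    have h2 := mul_le_mul_of_nonneg_right hcs (sq_nonneg (n : ℝ))
    linarith
  have hcon : P - P / D * D = 0 := by
    -- If d vanishes below n, then P = 0 and the default value P / 0 = 0 is the right multiplier.
    by_cases h0 : D = 0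
    · rw [h0, mul_zero] at hPD
      have : P ^ 2 = 0 := by
        have h1 : 0 < (n : ℝ) ^ 2 := by positivity
        exact le_antisymm (nonpos_of_mul_nonpos_left hPD h1) (sq_nonneg _)
      rw [pow_eq_zero_iff two_ne_zero] at this
      simp [this]
    · rw [div_mul_cancel₀ _ h0, sub_self]
  -- This multiplier gives the orthogonal projection onto the hyperplane d^⊥.
  refine ⟨P / D, ?_, ?_⟩
  · rw [← hcon, hP, hD, Finset.mul_sum, ← Finset.sum_sub_distrib]
    exact Finset.sum_congr rfl fun k _ => by ring
  · have e : x - ∑ k ∈ Finset.range n, (inner ℝ x (b k) - P / D * d k) • b k =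
        (x - ∑ k ∈ Finset.range n, inner ℝ x (b k) • b k) +
          ∑ k ∈ Finset.range n, (P / D * d k) • b k := by
      simp only [sub_smul, Finset.sum_sub_distrib]
      abel
    -- The norm is |P|/√D ≤ √3 E/n; rounding √3 up to 2 and adding the truncation error gives the
    -- constant 3.
    have h2 : ‖∑ k ∈ Finset.range n, (P / D * d k) • b k‖ ≤ 2 * (E / n) := by
      refine abs_le_of_sq_le_sq' (a := ‖_‖) ?_ (by positivity) |>.2
      have e2 : ‖∑ k ∈ Finset.range n, (P / D * d k) • b k‖ ^ 2 = P / D * (P / D * D) := by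
        rw [← real_inner_self_eq_norm_sq, hb.inner_sum, hD, Finset.mul_sum, Finset.mul_sum]
        refine Finset.sum_congr rfl fun k _ => ?_
        simp only [conj_trivial]; ring
      rw [e2, mul_pow, div_pow, mul_div_assoc', le_div_iff₀ (by positivity)]
      rcases hD0.eq_or_lt with h0 | h0
      · rw [← h0]; simp; positivity
      · rw [div_mul_cancel₀ _ h0.ne', div_mul_eq_mul_div, div_mul_eq_mul_div, div_le_iff₀ h0]
        nlinarith [mul_nonneg (sq_nonneg E) hD0]
    rw [e]
    refine (norm_add_le _ _).trans ?_
    linarith [norm_sub_sum_le_div hb hc hE h hn]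

end Hilbert

/-! ### Endpoint slopes and membership in W -/

/-- The slope of `h_{k+1}^m` at `r = 1`. -/
noncomputable def radialSlope (m k : ℕ) : ℝ :=
  2 * √(((k : ℝ) + 1) + ((m : ℝ) - 1) / 2) * (m + 2 * (k * (k + m + 1)))

theorem derivative_radialPoly_eval_one (m k : ℕ) :
    (derivative (radialPoly m (k + 1))).eval 1 = radialSlope m k := by
  rw [radialPoly_eq_radialLift, derivative_radialLift_eval_one, radialCore, derivative_C_mul,
    eval_mul, eval_mul, eval_C, zernikePoly_eval_zero, derivative_zernikePoly_eval_zero,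
    radialSlope]
  ring

theorem derivative_radialPoly_eval_neg_one (m k : ℕ) :
    (derivative (radialPoly m (k + 1))).eval (-1) = -(-1) ^ m * radialSlope m k := by
  rw [← derivative_radialPoly_eval_one, radialPoly_eq_radialLift,
    derivative_radialLift_eval_neg_one]

/-- After division by k+1 the unnormalized slope is 2k + 2m - m/(k+1), which increases with k, as
does the squared normalization. No constant depends on m. -/
theorem monotone_radialSlope (m : ℕ) :
    Monotone fun k => radialSlope m k ^ 2 / ((k : ℝ) + 1) ^ 2 := by
  have e : ∀ k : ℕ, radialSlope m k ^ 2 / ((k : ℝ) + 1) ^ 2 =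
      2 * ((m : ℝ) + 2 * k + 1) * ((m + 2 * (k * (k + m + 1))) / ((k : ℝ) + 1)) ^ 2 := by
    intro k
    rw [radialSlope, mul_pow, sq_normalization, div_pow, mul_div_assoc]
  simp only [e]
  refine monotone_nat_of_le_succ fun k => ?_
  push_cast
  refine mul_le_mul (by linarith) (pow_le_pow_left₀ (by positivity) ?_ 2) (by positivity)
    (by positivity)
  rw [div_le_div_iff₀ (by positivity) (by positivity)]
  have hm : (0 : ℝ) ≤ m := by positivity
  have hk : (0 : ℝ) ≤ k := by positivity
  nlinarith [mul_nonneg hm hk, mul_nonneg hk hk, mul_nonneg (mul_nonneg hk hk) hk,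
    mul_nonneg hm (mul_nonneg hk hk)]

theorem sq_le_zernikeEig {m k : ℕ} (h : 1 ≤ m ∨ 1 ≤ k) : ((k : ℝ) + 1) ^ 2 ≤ zernikeEig m k := by
  have hm : (0 : ℝ) ≤ m := by positivity
  have hk : (0 : ℝ) ≤ k := by positivity
  rw [zernikeEig]
  rcases h with h | h
  · have h : (1 : ℝ) ≤ m := by exact_mod_cast h
    nlinarith [mul_nonneg hm hk, mul_nonneg hk hk]
  · have h : (1 : ℝ) ≤ k := by exact_mod_cast h
    nlinarith [mul_nonneg hm hk, mul_nonneg hk hk]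

theorem norm_sub_starProjection_le (U : Submodule ℝ L2r) [U.HasOrthogonalProjection] (x : L2r)
    {w : L2r} (hw : w ∈ U) : ‖x - U.starProjection x‖ ≤ ‖x - w‖ := by
  rw [U.starProjection_minimal x]
  exact ciInf_le ⟨0, by rintro _ ⟨y, rfl⟩; exact norm_nonneg _⟩ (⟨w, hw⟩ : U)

theorem polyToL2r_one_eq_radialLift : polyToL2r 1 = polyToL2r (radialLift 0 (X ^ 0)) := by
  simp [radialLift_apply]

theorem inner_one_radialBasis_zero (k : ℕ) (hk : 1 ≤ k) :
    inner ℝ (radialBasis 0 k) (polyToL2r 1) = 0 := by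
  rw [radialBasis_eq, inner_smul_left, polyToL2r_one_eq_radialLift,
    inner_zernikeL2_X_pow 0 k 0 hk, mul_zero]

theorem sum_radialPoly_mem_polyW {m n : ℕ} {c : ℕ → ℝ}
    (hc : ∑ k ∈ Finset.range n, c k * radialSlope m k = 0) (hm : m = 0 → c 0 = 0) :
    ∑ k ∈ Finset.range n, c k • radialPoly m (k + 1) ∈ polyW m n := by
  refine ⟨?_, ?_, ?_, ?_⟩
  · refine Submodule.sum_mem _ fun k hk => Submodule.smul_mem _ _ (Submodule.subset_span ?_)
    exact ⟨k + 1, ⟨by omega, Finset.mem_range.1 hk⟩, rfl⟩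
  · simpa [derivative_sum, eval_finsetSum, derivative_radialPoly_eval_one] using hc
  · simp only [derivative_sum, eval_finsetSum, derivative_smul, eval_smul, smul_eq_mul,
      derivative_radialPoly_eval_neg_one]
    rw [← mul_zero (-(-1) ^ m : ℝ), ← hc, Finset.mul_sum]
    exact Finset.sum_congr rfl fun k _ => by ring
  · rintro rfl
    have h : inner ℝ (polyToL2r (∑ k ∈ Finset.range n, c k • radialPoly 0 (k + 1)))
        (polyToL2r 1) = 0 := by
      rw [map_sum, sum_inner]
      refine Finset.sum_eq_zero fun k _ => ?_
      rw [map_smul, inner_smul_left]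
      rcases Nat.eq_zero_or_pos k with rfl | hk
      · rw [hm rfl]; simp
      · have := inner_one_radialBasis_zero k hk
        rw [radialBasis] at this
        rw [this, mul_zero]
    rw [inner_polyToL2r_polyToL2r] at h
    refine (intervalIntegral.integral_congr fun r _ => ?_).trans h
    simp only [eval_one]
    ring

theorem norm_sub_starProjection_W_le {m : ℕ} {ξ ξ' η : L2r} (h : HasWeakDeriv ξ ξ')
    (h0 : IntegrableOn ξ (Ioo 0 1))
    (hη : 1 ≤ m → ∀ᵐ r ∂volume.restrict (Ioo (0 : ℝ) 1), ξ r = r * η r)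
    (hmean : m = 0 → inner ℝ ξ (polyToL2r 1) = 0) {n : ℕ} (hn : 1 ≤ n) :
    ‖ξ - (W m n).starProjection ξ‖ ≤ 3 * (n : ℝ)⁻¹ * ((m : ℝ) * ‖η‖ + ‖ξ'‖) := by
  have ha0 : m = 0 → inner ℝ ξ (radialBasis m 0) = 0 := by
    rintro rfl
    have : zernikeL2 0 0 = polyToL2r 1 := by
      simp [zernikeL2, zernikePoly, zernikeCoeff_zero, radialLift_apply]
    rw [radialBasis_eq, inner_smul_right, this, hmean rfl, mul_zero]
  have hsum : ∀ n, ∑ k ∈ Finset.range n, ((k : ℝ) + 1) ^ 2 * inner ℝ ξ (radialBasis m k) ^ 2 ≤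
      ((m : ℝ) * ‖η‖ + ‖ξ'‖) ^ 2 := by
    intro n
    refine le_trans (Finset.sum_le_sum fun k _ => ?_) (sum_zernikeEig_mul_sq_le h h0 hη n)
    by_cases hk : 1 ≤ m ∨ 1 ≤ k
    · exact mul_le_mul_of_nonneg_right (sq_le_zernikeEig hk) (sq_nonneg _)
    · obtain ⟨hm, hk⟩ : m = 0 ∧ k = 0 := by omega
      rw [hk, ha0 hm]; simp
  obtain ⟨γ, hγ, hle⟩ := exists_constrained_approx (orthonormal_radialBasis m)
    (fun f hf => eq_zero_of_forall_inner_radialBasis hf) (by positivity) hsum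
    (monotone_radialSlope m) hn
  -- For m = 0 both a_0 and d_0 vanish, so the correction preserves the zero mean.
  have hmem := sum_radialPoly_mem_polyW (m := m) (n := n)
    (c := fun k => inner ℝ ξ (radialBasis m k) - γ * radialSlope m k) hγ (by
      intro hm
      simp only [ha0 hm]
      simp [radialSlope, hm])
  have hw : ∑ k ∈ Finset.range n,
      (inner ℝ ξ (radialBasis m k) - γ * radialSlope m k) • radialBasis m k ∈ W m n := by
    refine ⟨_, hmem, ?_⟩
    rw [map_sum]
    exact Finset.sum_congr rfl fun k _ => by rw [map_smul]; rfl
  refine (norm_sub_starProjection_le _ _ hw).trans (hle.trans_eq ?_)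
  rw [div_eq_mul_inv]; ring

/-- Membership in L²_r only makes rξ integrable, which suffices on r ≥ δ; boundedness handles r < δ.
-/
theorem BoundedNearZero.integrableOn {ξ : L2r} (h : BoundedNearZero ξ) :
    IntegrableOn ξ (Ioo 0 1) := by
  obtain ⟨g, hg, -, B, hB⟩ := h
  obtain ⟨δ, hδ, hδB⟩ := mem_nhdsGT_iff_exists_Ioo_subset.1 hB
  have hδ : 0 < δ := hδ
  have hconst : IntegrableOn (fun _ : ℝ => |B|) (Ioo 0 1) := integrableOn_const (by simp)
  refine Integrable.mono' (hconst.add ((integrableOn_id_mul_L2r ξ).abs.const_mul δ⁻¹))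
    (Lp.stronglyMeasurable ξ).aestronglyMeasurable ?_
  filter_upwards [hg, ae_restrict_mem measurableSet_Ioo] with r hr hr'
  simp only [Pi.add_apply, Real.norm_eq_abs]
  rcases lt_or_ge r δ with hlt | hge
  · have : |g r| ≤ B := hδB ⟨hr'.1, hlt⟩
    rw [← hr]
    have : 0 ≤ δ⁻¹ * |r * g r| := by positivity
    linarith [le_abs_self B]
  · have h1 : |ξ r| ≤ δ⁻¹ * |r * ξ r| := by
      rw [abs_mul, abs_of_pos hr'.1, ← mul_assoc]
      refine le_mul_of_one_le_left (abs_nonneg _) ?_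
      rw [inv_mul_eq_div, one_le_div hδ]
      exact hge
    linarith [abs_nonneg B]

end IceFishing

theorem lemma4p2 :
    ∃ C : ℝ, 0 < C ∧ ∀ n : ℕ, 1 ≤ n →
      (∀ m : ℕ, 1 ≤ m → ∀ Bo : ℝ, 0 < Bo → ∀ (ω : ℝ) (ξ : L2r),
        IsWeakSloshingEigenpair m Bo ω ξ →
        ∀ hξr : MemLp (fun r => ξ r / r) 2 radialMeasure,
        ∀ ξ' : L2r, HasWeakDeriv ξ ξ' →
          ‖ξ - (W m n).starProjection ξ‖ ≤
            C * (n : ℝ)⁻¹ * ((m : ℝ) * ‖hξr.toLp (fun r => ξ r / r)‖ + ‖ξ'‖)) ∧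
      (∀ ξ ∈ V 0, ∀ ξ' : L2r, HasWeakDeriv ξ ξ' →
          ‖ξ - (W 0 n).starProjection ξ‖ ≤ C * (n : ℝ)⁻¹ * ‖ξ'‖) := by
  refine ⟨3, by norm_num, fun n hn => ⟨fun m hm Bo _ ω ξ _ hξr ξ' hξ' => ?_,
    fun ξ hξ ξ' hξ' => ?_⟩⟩
  · have hη : ∀ᵐ r ∂volume.restrict (Ioo (0 : ℝ) 1),
        ξ r = r * hξr.toLp (fun r => ξ r / r) r := by
      filter_upwards [ae_radialMeasure_iff.1 hξr.coeFn_toLp, ae_restrict_mem measurableSet_Ioo]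
        with r hr hr'
      rw [hr, mul_div_cancel₀ _ hr'.1.ne']
    have h0 : IntegrableOn ξ (Ioo 0 1) :=
      (integrableOn_id_mul_L2r (hξr.toLp _)).congr (by
        filter_upwards [hη] with r hr using hr.symm)
    exact norm_sub_starProjection_W_le hξ' h0 (fun _ => hη) (fun h => by omega) hn
  · obtain ⟨_, _, _, _, _, hV, _⟩ := hξ
    obtain ⟨hbdd, hmean⟩ := hV rfl
    -- For m = 0 the function η enters only with the factor m, so any choice serves.
    have h := norm_sub_starProjection_W_le (m := 0) (η := 0) hξ' hbdd.integrableOn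
      (fun h => by omega) (fun _ => ?_) hn
    · simpa using h
    · rw [intervalIntegral_eq_Ioo] at hmean
      simpa [inner_polyToL2r] using hmean
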